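/- Let $d\ge 1$ and $\Delta\ge 1$, and let $K\subset\mathbb R^d$ be a simple polytope, i.e. a convex polytope with non-empty interior each of whose vertices lies on exactly $d$ facets. Assume that the origin $\mathbf 0$ is a vertex of $K$, that $[0,\Delta]^d\subseteq K$, and that $K\subseteq[0,m\Delta]^d$ for some $m$. For $\lambda>1$ let $\mathcal P_\lambda$ be a homogeneous Poisson point process of intensity $\lambda$ on $K$, let $K_\lambda$ be the convex hull of $\mathcal P_\lambda$, and put $$\delta_0:=\exp\bigl(-(\log\lambda)^{1/d}\bigr),\qquad Q_0:=[0,\delta_0]^d .$$ For a non-empty face $F$ of $K_\lambda$ let $C_F(K_\lambda):=\{u\in\mathbb R^d\setminus\{0\}:\ \langle u,y-x\rangle\le 0 \text{ for all } x\in F,\ y\in K_\lambda\}$ be the set of its outward normal vectors. There is a constant $C\in(0,\infty)$, depending only on $d$, $\Delta$ and $K$, such that for every $\lambda>1$ there is an event $A_\lambda$ with $$P[A_\lambda^c]\le C(\log\lambda)^{-4d^2}$$ such that on $A_\lambda$ every face $F$ of $K_\lambda$ that meets $Q_0$ is cone-extreme, that is, $C_F(K_\lambda)\subset(-\infty,0)^d$.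 -/

import Mathlib

open MeasureTheory ProbabilityTheory Set
open scoped NNReal ENNReal

/-- A (convex) polytope: the convex hull of a finite set of points. -/
def IsPolytope {d : ℕ} (K : Set (EuclideanSpace ℝ (Fin d))) : Prop :=
  ∃ S : Finset (EuclideanSpace ℝ (Fin d)), K = convexHull ℝ (S : Set (EuclideanSpace ℝ (Fin d)))

/-- `F` is a nonempty face of `K`, i.e. the set of maximisers over `K` of a linear functional.
For the zero functional this is the improper face `K` itself. -/
def IsFace {d : ℕ} (K F : Set (EuclideanSpace ℝ (Fin d))) : Prop :=
  F.Nonempty ∧ IsExposed ℝ K F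

/-- A facet is a face of dimension `d - 1`. -/
def IsFacet {d : ℕ} (K F : Set (EuclideanSpace ℝ (Fin d))) : Prop :=
  IsFace K F ∧ Module.finrank ℝ (vectorSpan ℝ F) + 1 = d

/-- A simple polytope: a polytope with nonempty interior, each of whose vertices lies on exactly
`d` facets. -/
def IsSimplePolytope {d : ℕ} (K : Set (EuclideanSpace ℝ (Fin d))) : Prop :=
  IsPolytope K ∧ (interior K).Nonempty ∧
    ∀ x ∈ K.extremePoints ℝ, {F | IsFacet K F ∧ x ∈ F}.encard = d

/-- The cube `[0, r]^d`. -/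
def cube (d : ℕ) (r : ℝ) : Set (EuclideanSpace ℝ (Fin d)) :=
  {x | ∀ i, 0 ≤ x i ∧ x i ≤ r}

/-- The (nonzero) outward normal vectors to `K` along `F`, for a face `F` of a convex set `K`. -/
def outerNormals {d : ℕ} (K F : Set (EuclideanSpace ℝ (Fin d))) :
    Set (EuclideanSpace ℝ (Fin d)) :=
  {u | u ≠ 0 ∧ ∀ x ∈ F, ∀ y ∈ K, inner ℝ u (y - x) ≤ 0}

/-- The cone `(-∞, 0)^d` of outward normals at the vertex `0`. -/
def negativeCone (d : ℕ) : Set (EuclideanSpace ℝ (Fin d)) :=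
  {u | ∀ i, u i < 0}

/-- The face `F` of `L` is cone-extreme. -/
def IsConeExtreme {d : ℕ} (L F : Set (EuclideanSpace ℝ (Fin d))) : Prop :=
  outerNormals L F ⊆ negativeCone d

/-- `P` is a Poisson point process on `ℝ^d` with (diffuse) intensity measure `Λ`, realised as a
random locally finite set: the number of points in a Borel set `B` with `Λ B < ∞` is
Poisson distributed with mean `Λ B`, and the numbers of points in finitely many pairwise disjoint
Borel sets are independent. -/
structure IsPoissonProcess {d : ℕ} {Ω : Type*} [MeasurableSpace Ω] (μ : Measure Ω)
    (P : Ω → Set (EuclideanSpace ℝ (Fin d))) (Λ : Measure (EuclideanSpace ℝ (Fin d))) : Prop where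
  locallyFinite : ∀ ω, ∀ B, Bornology.IsBounded B → (P ω ∩ B).Finite
  measurable_count : ∀ B, MeasurableSet B → Measurable fun ω => (P ω ∩ B).encard
  count_law : ∀ B, MeasurableSet B → Λ B ≠ ∞ →
    μ.map (fun ω => (P ω ∩ B).encard)
      = (poissonMeasure (Λ B).toNNReal).map (fun n : ℕ => (n : ℕ∞))
  indep : ∀ (n : ℕ) (B : Fin n → Set (EuclideanSpace ℝ (Fin d))),
    (∀ i, MeasurableSet (B i)) → Pairwise (fun i j => Disjoint (B i) (B j)) →
    iIndepFun (fun i ω => (P ω ∩ B i).encard) μ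

/-- A homogeneous Poisson point process of intensity `lam` on `K`. -/
def IsHomogeneousPoisson {d : ℕ} {Ω : Type*} [MeasurableSpace Ω] (μ : Measure Ω)
    (P : Ω → Set (EuclideanSpace ℝ (Fin d))) (lam : ℝ) (K : Set (EuclideanSpace ℝ (Fin d))) :
    Prop :=
  (∀ ω, P ω ⊆ K) ∧ IsPoissonProcess μ P (ENNReal.ofReal lam • volume.restrict K)

/-- The side length `δ₀ = exp (-(log lam)^(1/d))`. -/
noncomputable def deltaZero (d : ℕ) (lam : ℝ) : ℝ :=
  Real.exp (-(Real.log lam) ^ (1 / (d : ℝ)))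

/-- The cube `Q₀ = [0, δ₀]^d`. -/
noncomputable def Qzero (d : ℕ) (lam : ℝ) : Set (EuclideanSpace ℝ (Fin d)) :=
  cube d (deltaZero d lam)

/-! Write `L = log λ`, `p = 4d²`, `s = λ⁻¹ L^(-(p+d))` and `δ = δ₀`. Two properties of the sample
suffice: no point has coordinate product below `s`, and every dyadic cell of volume at least `v = s
/ (4^d δ)` contains a point. The hull then lies in the convex set `{x > 0, ∏ xᵢ ≥ s}`. Let `x` be a
point of a face in `Q₀` and suppose that an outward normal `u` there has `u j ≥ 0`. Choose a cell
just beyond `x` in each coordinate, on the side given by the sign of `u i`, but use `(1/2, 1)` in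
coordinate `j`. As `x j ≤ δ`, this gains a factor `1/δ`, so the volume is at least `v`. A sample
point in the cell contradicts that `u` is an outward normal (`exists_dyadicCell_subset_halfspace`,
`isConeExtreme_of_forall_dyadicCell`). The first property fails with probability `O(λ s (log s⁻¹)^d)
= O(L^(-p))` (`volume_hyperbolicRegion_le`). For the second there are `O(L^d)` cells, each empty
with probability at most `exp(-λ v)`; since `1/δ = exp(L^(1/d))` beats every power of `L`, the sum
is again `O(L^(-p))` (`exists_failure_bound`). -/

/-! ### Void probabilities of Poisson processes -/

section Poisson

lemma setOf_inter_eq_empty_eq_preimage {d : ℕ} {Ω : Type*} (P : Ω → Set (EuclideanSpace ℝ (Fin d)))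
    (B : Set (EuclideanSpace ℝ (Fin d))) :
    {ω | P ω ∩ B = ∅} = (fun ω => (P ω ∩ B).encard) ⁻¹' {0} := by
  ext ω
  simp

variable {d : ℕ} {Ω : Type*} [MeasurableSpace Ω] {μ : Measure Ω}
  {P : Ω → Set (EuclideanSpace ℝ (Fin d))} {Λ : Measure (EuclideanSpace ℝ (Fin d))}

lemma IsPoissonProcess.measurableSet_void (h : IsPoissonProcess μ P Λ)
    {B : Set (EuclideanSpace ℝ (Fin d))} (hB : MeasurableSet B) :
    MeasurableSet {ω | P ω ∩ B = ∅} := by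
  rw [setOf_inter_eq_empty_eq_preimage]
  exact h.measurable_count B hB (measurableSet_singleton 0)

/-- The void probabilities of a Poisson point process. -/
lemma IsPoissonProcess.measure_void (h : IsPoissonProcess μ P Λ)
    {B : Set (EuclideanSpace ℝ (Fin d))} (hB : MeasurableSet B) (hΛ : Λ B ≠ ∞) :
    μ {ω | P ω ∩ B = ∅} = ENNReal.ofReal (Real.exp (-(Λ B).toReal)) := by
  rw [setOf_inter_eq_empty_eq_preimage,
    ← Measure.map_apply (h.measurable_count B hB) (measurableSet_singleton 0),
    h.count_law B hB hΛ, Measure.map_apply .of_discrete (measurableSet_singleton 0)]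
  have : (fun n : ℕ => (n : ℕ∞)) ⁻¹' {0} = {0} := by ext; simp
  rw [this, poissonMeasure_singleton]
  simp [ENNReal.toReal]

lemma IsPoissonProcess.measure_nonempty_le [IsProbabilityMeasure μ] (h : IsPoissonProcess μ P Λ)
    {B : Set (EuclideanSpace ℝ (Fin d))} (hB : MeasurableSet B) (hΛ : Λ B ≠ ∞) :
    μ {ω | P ω ∩ B = ∅}ᶜ ≤ Λ B := by
  rw [prob_compl_eq_one_sub (h.measurableSet_void hB), h.measure_void hB hΛ,
    ← ENNReal.ofReal_one, ← ENNReal.ofReal_sub _ (Real.exp_pos _).le]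
  refine ENNReal.ofReal_le_of_le_toReal ?_
  linarith [Real.add_one_le_exp (-(Λ B).toReal)]

end Poisson

/-! ### Volume near the coordinate hyperplanes -/

section Volume

variable {d : ℕ}

lemma setIntegral_Ioc_rpow {M r : ℝ} (hM : 0 ≤ M) (hr : r < 1) :
    ∫ t in Ioc 0 M, t ^ (-r) = M ^ (1 - r) / (1 - r) := by
  rw [← intervalIntegral.integral_of_le hM, integral_rpow (Or.inl (by linarith)),
    show -r + 1 = 1 - r by ring, Real.zero_rpow (by linarith), sub_zero]

/-- Markov's inequality for `∏ xᵢ ^ (-r)`, whose integral factorises and is finite because `r < 1`.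
The half-open box avoids the value of `rpow` at `0`. -/
lemma volume_pi_prod_lt_le {M s r : ℝ} (hM : 0 ≤ M) (hs : 0 < s) (hr0 : 0 ≤ r) (hr : r < 1) :
    volume {x : Fin d → ℝ | (∀ i, x i ∈ Ioc 0 M) ∧ ∏ i, x i < s}
      ≤ ENNReal.ofReal (s ^ r * (M ^ (1 - r) / (1 - r)) ^ d) := by
  set ν : Measure ℝ := volume.restrict (Ioc 0 M) with hν
  have hpi : Measure.pi (fun _ : Fin d => ν)
      = (volume : Measure (Fin d → ℝ)).restrict (univ.pi fun _ => Ioc 0 M) :=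
    (Measure.restrict_pi_pi _ _).symm
  have hint : Integrable (fun t : ℝ => t ^ (-r)) ν := by
    have := intervalIntegral.intervalIntegrable_rpow' (a := 0) (b := M) (r := -r) (by linarith)
    exact (intervalIntegrable_iff_integrableOn_Ioc_of_le hM).1 this
  have hintp : Integrable (fun x : Fin d → ℝ => ∏ i, x i ^ (-r)) (Measure.pi fun _ => ν) :=
    Integrable.fintype_prod (fun _ => hint)
  have hval : ∫ x : Fin d → ℝ, ∏ i, x i ^ (-r) ∂(Measure.pi fun _ => ν)
      = (M ^ (1 - r) / (1 - r)) ^ d := by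
    rw [integral_fintype_prod_eq_prod (fun (_ : Fin d) (t : ℝ) => t ^ (-r))]
    simp only [hν, setIntegral_Ioc_rpow hM hr, Finset.prod_const, Finset.card_univ,
      Fintype.card_fin]
  have hnn : 0 ≤ᵐ[Measure.pi fun _ : Fin d => ν] fun x => ∏ i, x i ^ (-r) := by
    rw [hpi]
    refine (ae_restrict_iff' (MeasurableSet.univ_pi fun _ => measurableSet_Ioc)).2 (.of_forall ?_)
    intro x hx
    exact Finset.prod_nonneg fun i _ => Real.rpow_nonneg (hx i trivial).1.le _
  have hmarkov := mul_meas_ge_le_integral_of_nonneg hnn hintp (s ^ (-r))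
  rw [hval] at hmarkov
  have hfin : (Measure.pi fun _ : Fin d => ν) {x | s ^ (-r) ≤ ∏ i, x i ^ (-r)} ≠ ∞ := by
    have : IsFiniteMeasure ν := by rw [hν]; infer_instance
    exact measure_ne_top _ _
  have hsub : {x : Fin d → ℝ | (∀ i, x i ∈ Ioc 0 M) ∧ ∏ i, x i < s}
      ⊆ {x | s ^ (-r) ≤ ∏ i, x i ^ (-r)} ∩ univ.pi fun _ => Ioc 0 M := by
    rintro x ⟨hx, hxs⟩
    refine ⟨?_, fun i _ => hx i⟩
    rw [mem_ofPred_eq, Real.finsetProd_rpow _ _ fun i _ => (hx i).1.le]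
    exact Real.rpow_le_rpow_of_nonpos (Finset.prod_pos fun i _ => (hx i).1) hxs.le (by linarith)
  calc volume {x : Fin d → ℝ | (∀ i, x i ∈ Ioc 0 M) ∧ ∏ i, x i < s}
      ≤ volume ({x : Fin d → ℝ | s ^ (-r) ≤ ∏ i, x i ^ (-r)} ∩ univ.pi fun _ => Ioc 0 M) :=
        measure_mono hsub
    _ = (Measure.pi fun _ : Fin d => ν) {x | s ^ (-r) ≤ ∏ i, x i ^ (-r)} := by
        rw [hpi, Measure.restrict_apply' (MeasurableSet.univ_pi fun _ => measurableSet_Ioc)]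
    _ ≤ _ := by
        rw [← ENNReal.ofReal_toReal hfin]
        refine ENNReal.ofReal_le_ofReal ?_
        rw [Real.rpow_neg hs.le] at hmarkov
        rw [Real.rpow_neg hs.le]
        exact (inv_mul_le_iff₀ (Real.rpow_pos_of_pos hs r)).1 hmarkov

/-- The part of the cube `[0, M]^d` where the product of the coordinates is less than `s`. -/
def hyperbolicRegion (d : ℕ) (M s : ℝ) : Set (EuclideanSpace ℝ (Fin d)) :=
  {x | x ∈ cube d M ∧ ∏ i, x i < s}

lemma measurableSet_hyperbolicRegion (d : ℕ) (M s : ℝ) :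
    MeasurableSet (hyperbolicRegion d M s) := by
  have : hyperbolicRegion d M s
      = (⋂ i, (fun x : EuclideanSpace ℝ (Fin d) => x i) ⁻¹' Icc 0 M)
        ∩ (fun x : EuclideanSpace ℝ (Fin d) => ∏ i, x i) ⁻¹' Iio s := by
    ext x; simp [hyperbolicRegion, cube]
  rw [this]
  refine MeasurableSet.inter (MeasurableSet.iInter fun i => ?_) ?_
  · exact measurableSet_Icc.preimage (by fun_prop)
  · exact measurableSet_Iio.preimage (by fun_prop)

lemma volume_hyperbolicRegion_le_rpow {M s r : ℝ} (hM : 0 ≤ M) (hs : 0 < s) (hr0 : 0 ≤ r)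
    (hr : r < 1) :
    volume (hyperbolicRegion d M s) ≤ ENNReal.ofReal (s ^ r * (M ^ (1 - r) / (1 - r)) ^ d) := by
  have hmp := EuclideanSpace.volume_preserving_symm_measurableEquiv_toLp (Fin d)
  rw [← hmp.symm.measure_preimage_equiv]
  refine (measure_mono_ae ?_).trans (volume_pi_prod_lt_le hM hs hr0 hr)
  have hne : ∀ᵐ x : Fin d → ℝ, ∀ i, x i ≠ 0 := by
    rw [ae_all_iff]
    intro i
    exact (Measure.quasiMeasurePreserving_eval (fun _ : Fin d => (volume : Measure ℝ)) i).ae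
      (Measure.ae_ne volume 0)
  filter_upwards [hne] with x hx h
  exact ⟨fun i => ⟨lt_of_le_of_ne (h.1 i).1 (hx i).symm, (h.1 i).2⟩, h.2⟩

/-- The choice `r = 1 - 1 / log s⁻¹` in the Markov bound turns `s ^ r` into `e s` and `1 / (1 - r)`
into `log s⁻¹`. -/
lemma volume_hyperbolicRegion_le {M s : ℝ} (hM : 1 ≤ M) (hs : 0 < s)
    (hℓ : 1 ≤ Real.log s⁻¹) :
    volume (hyperbolicRegion d M s)
      ≤ ENNReal.ofReal (Real.exp 1 * s * (M * Real.log s⁻¹) ^ d) := by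
  set ℓ := Real.log s⁻¹ with hdef
  have hℓ0 : 0 < ℓ := by linarith
  have h1 : ℓ⁻¹ ≤ 1 := inv_le_one_of_one_le₀ hℓ
  refine (volume_hyperbolicRegion_le_rpow (r := 1 - ℓ⁻¹) (by linarith) hs (by linarith)
    (by linarith [inv_pos.2 hℓ0])).trans (ENNReal.ofReal_le_ofReal ?_)
  have hsr : s ^ (1 - ℓ⁻¹) = Real.exp 1 * s := by
    rw [Real.rpow_def_of_pos hs]
    have : Real.log s = -ℓ := by rw [hdef, Real.log_inv, neg_neg]
    rw [this, show -ℓ * (1 - ℓ⁻¹) = 1 + -ℓ by field_simp; ring, Real.exp_add, ← this,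
      Real.exp_log hs]
  rw [hsr, sub_sub_cancel, div_inv_eq_mul]
  gcongr
  calc M ^ ℓ⁻¹ ≤ M ^ (1 : ℝ) := Real.rpow_le_rpow_of_exponent_le hM h1
    _ = M := Real.rpow_one M

end Volume

/-! ### Dyadic cells and convexity of the product's superlevel sets -/

section Dyadic

variable {d : ℕ}

/-- The open dyadic cell `∏ (2^(-m i - 1), 2^(-m i))`. -/
def dyadicCell (m : Fin d → ℕ) : Set (EuclideanSpace ℝ (Fin d)) :=
  {x | ∀ i, x i ∈ Ioo ((1 / 2 : ℝ) ^ (m i + 1)) ((1 / 2) ^ m i)}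

lemma measurableSet_dyadicCell (m : Fin d → ℕ) : MeasurableSet (dyadicCell m) := by
  have : dyadicCell m = ⋂ i, {x : EuclideanSpace ℝ (Fin d) |
      x i ∈ Ioo ((1 / 2 : ℝ) ^ (m i + 1)) ((1 / 2) ^ m i)} := by
    ext; simp [dyadicCell]
  rw [this]
  exact MeasurableSet.iInter fun i =>
    measurableSet_Ioo.preimage (f := fun x : EuclideanSpace ℝ (Fin d) => x i) (by fun_prop)

lemma volume_dyadicCell (m : Fin d → ℕ) :
    volume (dyadicCell m) = ENNReal.ofReal (∏ i, (1 / 2 : ℝ) ^ (m i + 1)) := by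
  have hmp := EuclideanSpace.volume_preserving_symm_measurableEquiv_toLp (Fin d)
  rw [← hmp.symm.measure_preimage_equiv]
  have : (MeasurableEquiv.toLp 2 (Fin d → ℝ)).symm.symm ⁻¹' dyadicCell m
      = univ.pi fun i => Ioo ((1 / 2 : ℝ) ^ (m i + 1)) ((1 / 2) ^ m i) := by
    ext; simp [dyadicCell]
  rw [this, Real.volume_pi_Ioo, ENNReal.ofReal_prod_of_nonneg fun i _ => by positivity]
  congr! 2 with i
  ring

lemma dyadicCell_subset_cube (m : Fin d → ℕ) {r : ℝ} (hr : 1 ≤ r) : dyadicCell m ⊆ cube d r := by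
  intro x hx i
  refine ⟨le_trans (by positivity) (hx i).1.le, (hx i).2.le.trans (le_trans ?_ hr)⟩
  exact pow_le_one₀ (by norm_num) (by norm_num)

/-- Weighted AM-GM in each coordinate, then multiplication over the coordinates. -/
lemma convex_setOf_le_prod {s : ℝ} (hs : 0 < s) :
    Convex ℝ {x : EuclideanSpace ℝ (Fin d) | (∀ i, 0 < x i) ∧ s ≤ ∏ i, x i} := by
  rintro x ⟨hx, hxs⟩ y ⟨hy, hys⟩ a b ha hb hab
  have hle : ∀ i, x i ^ a * y i ^ b ≤ (a • x + b • y) i := fun i => by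
    simpa using Real.geom_mean_le_arith_mean2_weighted ha hb (hx i).le (hy i).le hab
  have hpos : ∀ i, 0 < x i ^ a * y i ^ b := fun i =>
    mul_pos (Real.rpow_pos_of_pos (hx i) a) (Real.rpow_pos_of_pos (hy i) b)
  refine ⟨fun i => (hpos i).trans_le (hle i), ?_⟩
  calc s = s ^ a * s ^ b := by rw [← Real.rpow_add hs, hab, Real.rpow_one]
    _ ≤ (∏ i, x i) ^ a * (∏ i, y i) ^ b :=
        mul_le_mul (Real.rpow_le_rpow hs.le hxs ha) (Real.rpow_le_rpow hs.le hys hb)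
          (Real.rpow_nonneg hs.le b) (Real.rpow_nonneg (hs.le.trans hxs) a)
    _ = ∏ i, x i ^ a * y i ^ b := by
        rw [Finset.prod_mul_distrib, Real.finsetProd_rpow _ _ fun i _ => (hx i).le,
          Real.finsetProd_rpow _ _ fun i _ => (hy i).le]
    _ ≤ ∏ i, (a • x + b • y) i := Finset.prod_le_prod (fun i _ => (hpos i).le) fun i _ => hle i

end Dyadic

/-! ### Faces near the origin, and counting large cells -/

section Faces

variable {d : ℕ}

/-- If a vector `u` has a nonnegative coordinate, then near a point `x` of the positive orthant
whose coordinates are all at most `δ`, some large dyadic cell lies in the halfspace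
`⟪u, y - x⟫ > 0`. -/
lemma exists_dyadicCell_subset_halfspace {s δ : ℝ} (hδ0 : 0 < δ) (hδ : δ ≤ 1 / 2)
    {x u : EuclideanSpace ℝ (Fin d)} (hx : ∀ i, 0 < x i) (hxδ : ∀ i, x i ≤ δ)
    (hxs : s ≤ ∏ i, x i) (hu : u ≠ 0) {j : Fin d} (hj : 0 ≤ u j) :
    ∃ m : Fin d → ℕ, s / (4 ^ d * δ) ≤ ∏ i, (1 / 2 : ℝ) ^ (m i + 1) ∧
      ∀ y ∈ dyadicCell m, 0 < inner ℝ u (y - x) := by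
  -- Bracketing `2 * x i ≤ 1` instead of `x i` leaves room for the cell of index `k` above `x i`;
  -- the cell of index `k + 2` lies below it.
  have hk : ∀ i, ∃ k : ℕ, (1 / 2 : ℝ) ^ (k + 2) < x i ∧ x i ≤ (1 / 2) ^ (k + 1) := fun i => by
    obtain ⟨k, h1, h2⟩ := exists_nat_pow_near_of_lt_one (x := 2 * x i) (y := (1 / 2 : ℝ))
      (by linarith [hx i]) (by linarith [hxδ i]) (by norm_num) (by norm_num)
    refine ⟨k, ?_, ?_⟩
    · rw [pow_succ]; linarith
    · rw [pow_succ]; linarith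
  choose k hk1 hk2 using hk
  let m : Fin d → ℕ := fun i => if i = j then 0 else if 0 ≤ u i then k i else k i + 2
  have hlt : ∀ y ∈ dyadicCell m, ∀ i, u i ≠ 0 → 0 < u i * (y i - x i) := by
    intro y hy i hui
    have hyi := hy i
    by_cases hij : i = j
    · simp only [m, hij, if_true] at hyi
      have hu' : 0 < u i := lt_of_le_of_ne (hij ▸ hj) hui.symm
      refine mul_pos hu' ?_
      have := hxδ i
      rw [hij] at this ⊢
      norm_num at hyi
      linarith [hyi.1]
    · by_cases h0 : 0 ≤ u i
      · simp only [m, hij, h0, if_true, if_false] at hyi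
        exact mul_pos (lt_of_le_of_ne h0 hui.symm) (by linarith [hyi.1, hk2 i])
      · simp only [m, hij, h0, if_false] at hyi
        exact mul_pos_of_neg_of_neg (not_le.1 h0) (by linarith [hyi.2, hk1 i])
  refine ⟨m, ?_, fun y hy => ?_⟩
  · have hcoord : ∀ i, (if i = j then 1 / δ else 1) * (x i / 4) ≤ (1 / 2 : ℝ) ^ (m i + 1) := by
      intro i
      by_cases hij : i = j
      · simp only [m, hij, if_true]
        have : 1 / δ * (x j / 4) ≤ 1 / δ * (δ / 4) := by gcongr; exact hxδ j
        refine this.trans ?_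
        rw [one_div, inv_mul_eq_div, div_right_comm, div_self hδ0.ne']
        norm_num
      · have h2 : x i / 4 ≤ (1 / 2 : ℝ) ^ (k i + 2 + 1) := by
          have := hk2 i
          rw [show k i + 2 + 1 = k i + 1 + 2 by ring, pow_add]
          linarith
        simp only [m, hij, if_false, one_mul]
        split_ifs
        · exact h2.trans (pow_le_pow_of_le_one (by norm_num) (by norm_num) (by omega))
        · exact h2
    calc s / (4 ^ d * δ) ≤ (∏ i, x i) / (4 ^ d * δ) := by gcongr
      _ = ∏ i, (if i = j then 1 / δ else 1) * (x i / 4) := by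
          rw [Finset.prod_mul_distrib, Finset.prod_ite_eq' Finset.univ j,
            if_pos (Finset.mem_univ j), Finset.prod_div_distrib, Finset.prod_const,
            Finset.card_univ, Fintype.card_fin]
          field_simp
      _ ≤ _ := Finset.prod_le_prod (fun i _ => by split_ifs <;> have := hx i <;> positivity)
          fun i _ => hcoord i
  · have hsum : inner ℝ u (y - x) = ∑ i, u i * (y i - x i) := by
      simp [PiLp.inner_apply, mul_comm]
    rw [hsum]
    obtain ⟨i, hi⟩ : ∃ i, u i ≠ 0 := by
      by_contra! h
      exact hu (by ext i; exact h i)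
    refine Finset.sum_pos' (fun i _ => ?_) ⟨i, Finset.mem_univ i, hlt y hy i hi⟩
    by_cases h : u i = 0
    · simp [h]
    · exact (hlt y hy i h).le

/-- If a set of points in `[0, M]^d` avoids the region where the product of the coordinates is less
than `s` and meets all large dyadic cells, then the faces of its convex hull near the origin
are cone-extreme. -/
lemma isConeExtreme_of_forall_dyadicCell {s δ M : ℝ} (hs : 0 < s) (hδ0 : 0 < δ) (hδ : δ ≤ 1 / 2)
    {S : Set (EuclideanSpace ℝ (Fin d))} (hS : S ⊆ cube d M)
    (hvoid : S ∩ hyperbolicRegion d M s = ∅)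
    (hcell : ∀ m : Fin d → ℕ, s / (4 ^ d * δ) ≤ ∏ i, (1 / 2 : ℝ) ^ (m i + 1) →
      S ∩ dyadicCell m ≠ ∅)
    {F : Set (EuclideanSpace ℝ (Fin d))} (hF : IsFace (convexHull ℝ S) F)
    (hFδ : (F ∩ cube d δ).Nonempty) : IsConeExtreme (convexHull ℝ S) F := by
  obtain ⟨x, hxF, hxδ⟩ := hFδ
  have hxS : x ∈ convexHull ℝ S := hF.2.subset hxF
  have hsub : S ⊆ {x | (∀ i, 0 < x i) ∧ s ≤ ∏ i, x i} := by
    intro y hy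
    have hys : s ≤ ∏ i, y i := by
      by_contra! h
      exact (hvoid.subset ⟨hy, hS hy, h⟩).elim
    refine ⟨fun i => lt_of_le_of_ne (hS hy i).1 fun h => ?_, hys⟩
    rw [Finset.prod_eq_zero (Finset.mem_univ i) h.symm] at hys
    linarith
  obtain ⟨hx, hxs⟩ := convexHull_min hsub (convex_setOf_le_prod hs) hxS
  rintro u ⟨hu, hmax⟩ j
  by_contra! hj
  obtain ⟨m, hm, hpos⟩ := exists_dyadicCell_subset_halfspace hδ0 hδ hx (fun i => (hxδ i).2)
    hxs hu hj
  obtain ⟨y, hyS, hy⟩ := nonempty_iff_ne_empty.2 (hcell m hm)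
  exact (hpos y hy).not_ge (hmax x hxF y (subset_convexHull ℝ S hyS))

/-- All factors are at most `1`, so each is at least `v`; the factor `2` comes from `log 2 > 1/2`.
-/
lemma succ_le_of_le_prod_half_pow {v : ℝ} (hv : 0 < v) {m : Fin d → ℕ}
    (hm : v ≤ ∏ i, (1 / 2 : ℝ) ^ (m i + 1)) (i : Fin d) : (m i : ℝ) + 1 ≤ 2 * Real.log v⁻¹ := by
  have h1 : v ≤ (1 / 2 : ℝ) ^ (m i + 1) := by
    refine hm.trans ?_
    rw [← Finset.mul_prod_erase _ _ (Finset.mem_univ i)]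
    exact mul_le_of_le_one_right (by positivity)
      (Finset.prod_le_one (fun _ _ => by positivity)
        fun _ _ => pow_le_one₀ (by norm_num) (by norm_num))
  have h2 := Real.log_le_log hv h1
  rw [Real.log_pow, one_div, Real.log_inv] at h2
  push_cast at h2
  rw [Real.log_inv]
  nlinarith [Real.log_two_gt_d9, (m i).cast_nonneg (α := ℝ)]

/-- The finite set of indices of the dyadic cells of volume at least `v`. -/
noncomputable def largeCells (d : ℕ) (v : ℝ) : Finset (Fin d → ℕ) :=
  (Fintype.piFinset fun _ => Finset.range ⌊2 * Real.log v⁻¹⌋₊).filter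
    fun m => v ≤ ∏ i, (1 / 2 : ℝ) ^ (m i + 1)

/-- The truncation of the indices in `largeCells` discards no cell of volume at least `v`. -/
lemma mem_largeCells {v : ℝ} (hv : 0 < v) {m : Fin d → ℕ} :
    m ∈ largeCells d v ↔ v ≤ ∏ i, (1 / 2 : ℝ) ^ (m i + 1) := by
  simp only [largeCells, Finset.mem_filter, Fintype.mem_piFinset, Finset.mem_range,
    and_iff_right_iff_imp]
  intro hm i
  rw [← Nat.succ_le_iff]
  exact Nat.le_floor (by exact_mod_cast succ_le_of_le_prod_half_pow hv hm i)

lemma card_largeCells_le {v B : ℝ} (hv : Real.log v⁻¹ ≤ B) (hB : 0 ≤ B) :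
    ((largeCells d v).card : ℝ) ≤ (2 * B) ^ d := by
  have h : (largeCells d v).card ≤ ⌊2 * B⌋₊ ^ d := by
    refine (Finset.card_filter_le _ _).trans ?_
    simp only [Fintype.card_piFinset, Finset.card_range, Finset.prod_const, Finset.card_univ,
      Fintype.card_fin]
    gcongr
  calc ((largeCells d v).card : ℝ) ≤ (⌊2 * B⌋₊ : ℝ) ^ d := by exact_mod_cast h
    _ ≤ _ := by gcongr; exact Nat.floor_le (by positivity)

end Faces

/-! ### The good event -/

section Event

variable {d : ℕ} {Ω : Type*} [MeasurableSpace Ω] {μ : Measure Ω}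
  {P : Ω → Set (EuclideanSpace ℝ (Fin d))}

/-- Union bound over a point in the hyperbolic region and an empty large cell. The cells lie in `[0,
1]^d ⊆ K`, so they carry their full intensity. -/
lemma exists_event_isConeExtreme [IsProbabilityMeasure μ] {lam M s δ : ℝ}
    {K : Set (EuclideanSpace ℝ (Fin d))} (hlam : 0 < lam) (hM : 1 ≤ M) (hKM : K ⊆ cube d M)
    (hK1 : cube d 1 ⊆ K) (hP : IsHomogeneousPoisson μ P lam K) (hs : 0 < s)
    (hℓ : 1 ≤ Real.log s⁻¹) (hδ0 : 0 < δ) (hδ : δ ≤ 1 / 2) :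
    ∃ A : Set Ω, MeasurableSet A ∧
      μ Aᶜ ≤ ENNReal.ofReal (lam * (Real.exp 1 * s * (M * Real.log s⁻¹) ^ d)
        + (largeCells d (s / (4 ^ d * δ))).card * Real.exp (-(lam * (s / (4 ^ d * δ))))) ∧
      ∀ ω ∈ A, ∀ F : Set (EuclideanSpace ℝ (Fin d)), IsFace (convexHull ℝ (P ω)) F →
        (F ∩ cube d δ).Nonempty → IsConeExtreme (convexHull ℝ (P ω)) F := by
  set v := s / (4 ^ d * δ) with hvdef
  have hv : 0 < v := by positivity
  obtain ⟨hPK, hPP⟩ := hP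
  set Λ : Measure (EuclideanSpace ℝ (Fin d)) := ENNReal.ofReal lam • volume.restrict K with hΛ
  have hΛle : ∀ B, Λ B ≤ ENNReal.ofReal lam * volume B := fun B => by
    rw [hΛ, Measure.smul_apply, smul_eq_mul]
    gcongr
    exact Measure.restrict_le_self
  have hH : Λ (hyperbolicRegion d M s)
      ≤ ENNReal.ofReal (lam * (Real.exp 1 * s * (M * Real.log s⁻¹) ^ d)) := by
    rw [ENNReal.ofReal_mul hlam.le]
    exact (hΛle _).trans (by gcongr; exact volume_hyperbolicRegion_le hM hs hℓ)
  have hcell : ∀ m : Fin d → ℕ,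
      Λ (dyadicCell m) = ENNReal.ofReal (lam * ∏ i, (1 / 2 : ℝ) ^ (m i + 1)) := fun m => by
    rw [hΛ, Measure.smul_apply, smul_eq_mul, Measure.restrict_apply (measurableSet_dyadicCell m),
      inter_eq_left.2 ((dyadicCell_subset_cube m le_rfl).trans hK1), volume_dyadicCell,
      ENNReal.ofReal_mul hlam.le]
  have hempty : ∀ m ∈ largeCells d v,
      μ {ω | P ω ∩ dyadicCell m = ∅} ≤ ENNReal.ofReal (Real.exp (-(lam * v))) := fun m hm => by
    rw [hPP.measure_void (measurableSet_dyadicCell m) (by rw [hcell]; exact ENNReal.ofReal_ne_top),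
      hcell, ENNReal.toReal_ofReal (by positivity)]
    refine ENNReal.ofReal_le_ofReal (Real.exp_le_exp.2 (neg_le_neg ?_))
    exact mul_le_mul_of_nonneg_left ((mem_largeCells hv).1 hm) hlam.le
  refine ⟨({ω | P ω ∩ hyperbolicRegion d M s = ∅}ᶜ
    ∪ ⋃ m ∈ largeCells d v, {ω | P ω ∩ dyadicCell m = ∅})ᶜ, ?_, ?_, ?_⟩
  · exact ((hPP.measurableSet_void (measurableSet_hyperbolicRegion d M s)).compl.union
      (Finset.measurableSet_biUnion _ fun m _ =>
        hPP.measurableSet_void (measurableSet_dyadicCell m))).compl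
  · rw [compl_compl]
    have hℓ0 : 0 ≤ Real.log s⁻¹ := by linarith
    rw [ENNReal.ofReal_add (by positivity) (by positivity)]
    refine (measure_union_le _ _).trans (add_le_add ?_ ?_)
    · exact (hPP.measure_nonempty_le (measurableSet_hyperbolicRegion d M s)
        (hH.trans_lt ENNReal.ofReal_lt_top).ne).trans hH
    · refine (measure_biUnion_finset_le _ _).trans ((Finset.sum_le_sum hempty).trans ?_)
      rw [Finset.sum_const, nsmul_eq_mul, ENNReal.ofReal_mul (Nat.cast_nonneg _),
        ENNReal.ofReal_natCast]
  · intro ω hω F hF hFδ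
    simp only [mem_compl_iff, mem_union, mem_iUnion, not_or, not_not, not_exists] at hω
    exact isConeExtreme_of_forall_dyadicCell hs hδ0 hδ ((hPK ω).trans hKM) hω.1
      (fun m hm => hω.2 m ((mem_largeCells hv).2 hm)) hF hFδ

end Event

/-! ### Growth of the failure probability -/

section Asymptotics

open Filter Topology

/-- Makes the probability that one large cell is empty at most `L ^ (-q)`. It holds since `log L ≤
L` and `exp (L ^ b)` outgrows `L ^ (q + 1)`. -/
lemma eventually_mul_log_le_exp_rpow {q c : ℝ} {b : ℝ} (hc : 0 < c) (hb : 0 < b) (hq : 0 ≤ q) :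
    ∀ᶠ L : ℝ in atTop, q * Real.log L ≤ c * (L ^ (-q) * Real.exp (L ^ b)) := by
  have h1 := (tendsto_exp_div_rpow_atTop ((q + 1) / b)).comp (tendsto_rpow_atTop hb)
  filter_upwards [h1.eventually_ge_atTop (q / c), eventually_ge_atTop 1] with L hL hL1
  have hL0 : 0 < L := by linarith
  simp only [Function.comp_apply] at hL
  rw [← Real.rpow_mul hL0.le, mul_div_cancel₀ _ hb.ne', div_le_div_iff₀ hc (by positivity),
    Real.rpow_add hL0, Real.rpow_one] at hL
  have hlog : Real.log L ≤ L := (Real.log_le_sub_one_of_pos hL0).trans (by linarith)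
  have hLq : 0 < L ^ q := Real.rpow_pos_of_pos hL0 q
  rw [Real.rpow_neg hL0.le, inv_mul_eq_div, mul_div_assoc', le_div_iff₀ hLq]
  calc q * Real.log L * L ^ q ≤ q * L * L ^ q := by gcongr
    _ = q * (L ^ q * L) := by ring
    _ ≤ _ := by linarith

end Asymptotics

section Asymptotics

open Filter Topology

/-- With `s = λ⁻¹ (log λ)^(-(p + d))` and `δ = exp (-(log λ)^b)`, the failure probability of
`exists_event_isConeExtreme` is `O((log λ)^(-p))`. -/
lemma exists_failure_bound (d : ℕ) {p b M : ℝ} (hp : 0 ≤ p) (hb : 0 < b) (hM : 1 ≤ M) :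
    ∃ C : ℝ, 0 < C ∧ ∀ᶠ L : ℝ in atTop, ∀ s δ : ℝ, s = Real.exp (-L) * L ^ (-(p + d)) →
      δ = Real.exp (-L ^ b) → 1 ≤ Real.log s⁻¹ ∧ δ ≤ 1 / 2 ∧
      Real.exp L * (Real.exp 1 * s * (M * Real.log s⁻¹) ^ d)
        + (largeCells d (s / (4 ^ d * δ))).card * Real.exp (-(Real.exp L * (s / (4 ^ d * δ))))
        ≤ C * L ^ (-p) := by
  set q : ℝ := p + d with hqdef
  have hq : 0 ≤ q := by positivity
  -- One summand for the hyperbolic region, one for the cells; the `3` bounds `log 4`.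
  refine ⟨Real.exp 1 * (M * (1 + q)) ^ d + (2 * (1 + q + d * 3)) ^ d, by positivity, ?_⟩
  filter_upwards [eventually_mul_log_le_exp_rpow (q := q) (c := 1 / 4 ^ d) (by positivity) hb hq,
    (tendsto_rpow_atTop hb).eventually_ge_atTop (Real.log 2), eventually_ge_atTop 1]
    with L hL hL2 hL1
  rintro s δ hs hδ
  have hL0 : 0 < L := by linarith
  have hs0 : 0 < s := by rw [hs]; positivity
  have hδ0 : 0 < δ := by rw [hδ]; positivity
  have hδ2 : δ ≤ 1 / 2 := by
    rw [hδ, one_div, ← Real.exp_log (by norm_num : (0 : ℝ) < 2), ← Real.exp_neg]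
    exact Real.exp_le_exp.2 (neg_le_neg hL2)
  have hlogs : Real.log s⁻¹ = L + q * Real.log L := by
    rw [Real.log_inv, hs, Real.log_mul (by positivity) (by positivity), Real.log_exp,
      Real.log_rpow hL0]
    ring
  have hlog0 : 0 ≤ Real.log L := Real.log_nonneg hL1
  have hlog1 : Real.log L ≤ L := (Real.log_le_sub_one_of_pos hL0).trans (by linarith)
  have hℓ1 : 1 ≤ Real.log s⁻¹ := by rw [hlogs]; nlinarith
  have hℓ : Real.log s⁻¹ ≤ (1 + q) * L := by rw [hlogs]; nlinarith
  refine ⟨hℓ1, hδ2, ?_⟩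
  have hes : Real.exp L * s = L ^ (-q) := by
    rw [hs, ← mul_assoc, ← Real.exp_add, add_neg_cancel, Real.exp_zero, one_mul]
  -- The extra `d` in `q = p + d` pays for the factor `L ^ d` that occurs both in the volume and in
  -- the number of cells.
  have hLp : L ^ (-q) * L ^ d = L ^ (-p) := by
    rw [← Real.rpow_natCast, ← Real.rpow_add hL0]
    congr 1; rw [hqdef]; ring
  rw [add_mul]
  refine add_le_add ?_ ?_
  · calc Real.exp L * (Real.exp 1 * s * (M * Real.log s⁻¹) ^ d)
        = Real.exp 1 * (Real.exp L * s) * (M * Real.log s⁻¹) ^ d := by ring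
      _ ≤ Real.exp 1 * L ^ (-q) * (M * ((1 + q) * L)) ^ d := by rw [hes]; gcongr
      _ = Real.exp 1 * (M * (1 + q)) ^ d * (L ^ (-q) * L ^ d) := by rw [← mul_assoc, mul_pow]; ring
      _ = _ := by rw [hLp]
  · have hlv : Real.log (s / (4 ^ d * δ))⁻¹ = Real.log s⁻¹ + d * Real.log 4 + Real.log δ := by
      rw [inv_div, div_eq_mul_inv, mul_comm, Real.log_mul (by positivity) (by positivity),
        Real.log_mul (by positivity) (by positivity), Real.log_pow, add_assoc]
    have hlogδ : Real.log δ ≤ 0 := Real.log_nonpos hδ0.le (by linarith)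
    have hlog4 : Real.log 4 ≤ 3 := (Real.log_le_sub_one_of_pos (by norm_num)).trans (by norm_num)
    have hv1 : s / (4 ^ d * δ) = 1 / 4 ^ d * (s * Real.exp (L ^ b)) := by
      rw [hδ, Real.exp_neg]; field_simp
    have hexp : Real.exp (-(Real.exp L * (s / (4 ^ d * δ)))) ≤ L ^ (-q) := by
      rw [Real.rpow_def_of_pos hL0, hv1]
      refine Real.exp_le_exp.2 ?_
      have : Real.exp L * (1 / 4 ^ d * (s * Real.exp (L ^ b)))
          = 1 / 4 ^ d * (L ^ (-q) * Real.exp (L ^ b)) := by rw [← hes]; ring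
      rw [this]
      linarith
    have hup : Real.log (s / (4 ^ d * δ))⁻¹ ≤ (1 + q + d * 3) * L := by
      rw [hlv]
      have : (d : ℝ) * Real.log 4 ≤ d * 3 * L := by
        calc (d : ℝ) * Real.log 4 ≤ d * 3 * 1 := by rw [mul_one]; gcongr
          _ ≤ _ := by gcongr
      linarith
    have hcard := card_largeCells_le (d := d) hup (by positivity)
    calc _ ≤ (2 * ((1 + q + d * 3) * L)) ^ d * L ^ (-q) := by gcongr
      _ = (2 * (1 + q + d * 3)) ^ d * (L ^ (-q) * L ^ d) := by rw [← mul_assoc, mul_pow]; ring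
      _ = _ := by rw [hLp]

end Asymptotics

theorem proposition3p1 (d : ℕ) (hd : 1 ≤ d) (Δ : ℝ) (hΔ : 1 ≤ Δ)
    (K : Set (EuclideanSpace ℝ (Fin d))) (hK : IsSimplePolytope K)
    (h0 : (0 : EuclideanSpace ℝ (Fin d)) ∈ K.extremePoints ℝ)
    (hcube : cube d Δ ⊆ K) (hmult : ∃ m : ℝ, K ⊆ cube d (m * Δ)) :
    ∃ C : ℝ, 0 < C ∧ ∀ lam : ℝ, 1 < lam →
      ∀ (Ω : Type*) [MeasurableSpace Ω] (μ : Measure Ω) [IsProbabilityMeasure μ]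
        (P : Ω → Set (EuclideanSpace ℝ (Fin d))), IsHomogeneousPoisson μ P lam K →
        ∃ A : Set Ω, MeasurableSet A ∧
          μ Aᶜ ≤ ENNReal.ofReal (C * (Real.log lam) ^ (-(4 * (d : ℝ) ^ 2))) ∧
          ∀ ω ∈ A, ∀ F : Set (EuclideanSpace ℝ (Fin d)),
            IsFace (convexHull ℝ (P ω)) F → (F ∩ Qzero d lam).Nonempty →
            IsConeExtreme (convexHull ℝ (P ω)) F := by
  obtain ⟨m, hm⟩ := hmult
  have hd0 : (0 : ℝ) < d := by exact_mod_cast hd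
  set p : ℝ := 4 * (d : ℝ) ^ 2 with hp
  have hp0 : 0 ≤ p := by positivity
  obtain ⟨C, hC, hev⟩ := exists_failure_bound d (M := max (m * Δ) 1) hp0 (one_div_pos.2 hd0)
    (le_max_right _ _)
  obtain ⟨L₀, hL₀⟩ := Filter.eventually_atTop.1 hev
  -- The second summand makes the claimed bound at least `1` when `log lam < L₀`, where the empty
  -- event serves.
  refine ⟨C + max L₀ 0 ^ p, by positivity, fun lam hlam Ω _ μ _ P hP => ?_⟩
  have hlam0 : 0 < lam := by linarith
  have hL : 0 < Real.log lam := Real.log_pos hlam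
  rcases lt_or_ge (Real.log lam) L₀ with hlt | hge
  · refine ⟨∅, MeasurableSet.empty, ?_, fun ω hω => hω.elim⟩
    refine prob_le_one.trans ?_
    rw [← ENNReal.ofReal_one]
    refine ENNReal.ofReal_le_ofReal ?_
    have h1 : Real.log lam ^ p ≤ max L₀ 0 ^ p :=
      Real.rpow_le_rpow hL.le (hlt.le.trans (le_max_left _ _)) hp0
    calc (1 : ℝ) = Real.log lam ^ p * Real.log lam ^ (-p) := by
          rw [← Real.rpow_add hL, add_neg_cancel, Real.rpow_zero]
      _ ≤ _ := by gcongr; linarith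
  · obtain ⟨hℓ, hδ, hbound⟩ := hL₀ _ hge _ _ rfl rfl
    have hKM : K ⊆ cube d (max (m * Δ) 1) := fun x hx i =>
      ⟨(hm hx i).1, (hm hx i).2.trans (le_max_left _ _)⟩
    have hK1 : cube d 1 ⊆ K := fun x hx => hcube fun i => ⟨(hx i).1, (hx i).2.trans hΔ⟩
    obtain ⟨A, hA, hμA, hAF⟩ := exists_event_isConeExtreme hlam0 (le_max_right _ _) hKM hK1 hP
      (by positivity) hℓ (Real.exp_pos _) hδ
    rw [Real.exp_log hlam0] at hbound
    refine ⟨A, hA, hμA.trans (ENNReal.ofReal_le_ofReal (hbound.trans ?_)), hAF⟩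
    gcongr
    linarith [Real.rpow_nonneg (le_max_right L₀ 0) p]
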